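/- Let $K$ be a strong semiring, i.e. a Hausdorff topological semiring in which the product $(x_iy_j)_{(i,j)}$ of two summable families is summable; $k\in K$ is starrable if $k^*=\sum_{n\ge 0}k^n$ exists. Let $M$ be a graded monoid: it has an additive length that is positive on every element different from $1$, and each element has finitely many factorisations, so that the Cauchy product of series $M\to K$ is defined. $K$-expressions over $M$ are the formulas $$\mathsf E ::= \mathsf 0\mid \mathsf 1\mid m\ (m\in M\setminus\{1\})\mid k\,\mathsf E\mid \mathsf E\,k\ (k\in K)\mid \mathsf E+\mathsf E\mid \mathsf E\cdot\mathsf E\mid \mathsf E^*,$$ equality being equality of formulas. The constant term $c(\mathsf E)\in K$ is given by $c(\mathsf 0)=c(m)=0$, $c(\mathsf 1)=1$, $c(k\mathsf E)=k\,c(\mathsf E)$, $c(\mathsf Ek)=c(\mathsf E)k$, $c(\mathsf F+\mathsf G)=c(\mathsf F)+c(\mathsf G)$, $c(\mathsf F\cdot\mathsf G)=c(\mathsf F)c(\mathsf G)$, $c(\mathsf F^*)=c(\mathsf F)^*$; $\mathsf E$ is valid if $c(\mathsf F)$ is starrable for every subexpression $\mathsf F^*$ of $\mathsf E$. The series $|\mathsf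 E|$ denoted by $\mathsf E$ is obtained by interpreting the operators in the semiring of series $M\to K$ with the topology of simple convergence. A finite automaton $\mathcal A=\langle I,E,T\rangle$ has a finite set of states $Q$, $I,T\in K^Q$, and $E$ a $Q\times Q$-matrix of finite $K$-linear combinations of elements of $M\setminus\{1\}$; its behaviour is $I\,E^*\,T$. A surjective map $\varphi\colon Q\to R$ is a morphism from $\langle I,E,T\rangle$ onto $\langle J,F,U\rangle$ if $IX=J$, $EX=XF$ and $T=XU$, where $X_{q,r}=1$ if $\varphi(q)=r$ and $X_{q,r}=0$ otherwise; the second automaton is then a quotient of the first, and $\varphi$ merges two states if it gives them the same image. The image $\varphi(\mathcal A)$ is $\langle IX,YEX,YT\rangle$, where $Y$ is an $R\times Q$-matrix whose row of index $r$ is the unit vector of one chosen state of $\varphi^{-1}(r)$ (when $\varphi$ is a morphism onto $\varphi(\mathcal A)$, the choice does not matter). A standard automaton of dimension $P$ has states $\{i\}\sqcup P$ and is written $(c;J;F;U)$: the initial state $i$ has initial weight $1$ and final weight $c$, no transition enters $i$, $J$ is the row of transitions from $i$ to $P$, $F$ the matrix of transitions within $P$, $U$ the final weights on $P$, and all other initial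 weights are $0$. For $\mathcal A=(c;J;F;U)$ and $\mathcal B=(d;K;G;V)$ put $k\mathcal A=(kc;kJ;F;U)$, $\mathcal Ak=(ck;J;F;Uk)$, $\mathcal A+\mathcal B=\left(c+d;(J,K);\begin{pmatrix}F&0\\0&G\end{pmatrix};\begin{pmatrix}U\\V\end{pmatrix}\right)$, $\mathcal A\cdot\mathcal B=\left(cd;(J,cK);\begin{pmatrix}F&UK\\0&G\end{pmatrix};\begin{pmatrix}Ud\\V\end{pmatrix}\right)$ and $\mathcal A^*=(c^*;c^*J;Uc^*J+F;Uc^*)$. The position automaton $\mathcal S_{\mathsf E}$ is obtained by applying these operations along the formation of $\mathsf E$, starting from $\mathcal S_{\mathsf 0}$ and $\mathcal S_{\mathsf 1}$, of dimension $\emptyset$ with $c=0$ and $c=1$ respectively, and $\mathcal S_m=(0;(m);(0);(1))$ with one non-initial state. The finite set $\mathrm D(\mathsf E)$ of derived terms of $\mathsf E$ is defined by $\mathrm D(\mathsf 0)=\mathrm D(\mathsf 1)=\emptyset$, $\mathrm D(m)=\{\mathsf 1\}$, $\mathrm D(k\mathsf F)=\mathrm D(\mathsf F)$, $\mathrm D(\mathsf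 Fk)=\mathrm D(\mathsf F)k$, $\mathrm D(\mathsf F+\mathsf G)=\mathrm D(\mathsf F)\cup\mathrm D(\mathsf G)$, $\mathrm D(\mathsf F\cdot\mathsf G)=\mathrm D(\mathsf F)\cdot\mathsf G\cup\mathrm D(\mathsf G)$, $\mathrm D(\mathsf F^*)=\mathrm D(\mathsf F)\cdot\mathsf F^*$, where $\mathrm D(\mathsf F)k=\{\mathsf Hk:\mathsf H\in\mathrm D(\mathsf F)\}$ and $\mathrm D(\mathsf F)\cdot\mathsf G=\{\mathsf H\cdot\mathsf G:\mathsf H\in\mathrm D(\mathsf F)\}$. The standard automaton $\mathcal T_{\mathsf E}$, of dimension $\mathrm D(\mathsf E)$, is built in the same way as $\mathcal S_{\mathsf E}$, the states being renamed accordingly, except that $\mathcal T_{\mathsf F+\mathsf G}$ and $\mathcal T_{\mathsf F\cdot\mathsf G}$ are the images of $\mathcal T_{\mathsf F}+\mathcal T_{\mathsf G}$ and $\mathcal T_{\mathsf F}\cdot\mathcal T_{\mathsf G}$ by the natural maps $\mathrm D(\mathsf F)\sqcup\mathrm D(\mathsf G)\to\mathrm D(\mathsf F)\cup\mathrm D(\mathsf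 G)$ and $\mathrm D(\mathsf F)\cdot\mathsf G\sqcup\mathrm D(\mathsf G)\to\mathrm D(\mathsf F)\cdot\mathsf G\cup\mathrm D(\mathsf G)$, the initial state being kept apart. Let the initial state of $\mathcal T_{\mathsf E}$ be indexed by $\mathsf E$, let $\omega\colon\{\mathsf E\}\sqcup\mathrm D(\mathsf E)\to\{\mathsf E\}\cup\mathrm D(\mathsf E)$ be the natural map, and let the derived-term automaton of $\mathsf E$ be $\mathcal D_{\mathsf E}=\omega(\mathcal T_{\mathsf E})$. **Theorem.** For every valid $K$-expression $\mathsf E$ over $M$: 1. $\mathcal D_{\mathsf E}$ is a quotient of the position automaton $\mathcal S_{\mathsf E}$; 2. hence the series $|\mathsf E|$ is defined (all the stars in its definition exist) and $\mathcal D_{\mathsf E}$ realises it, i.e. the behaviour of $\mathcal D_{\mathsf E}$ is $|\mathsf E|$; 3. $\omega$ is a morphism from $\mathcal T_{\mathsf E}$ onto $\mathcal D_{\mathsf E}$; if $\mathsf E\in\mathrm D(\mathsf E)$ it merges the initial state with the state $\mathsf E$ and merges no other two distinct states, and if $\mathsf E\notin\mathrm D(\mathsf E)$ it is a bijection, so that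 $\mathcal D_{\mathsf E}$ is $\mathcal T_{\mathsf E}$. -/

import Mathlib

/-!
Weighted rational expressions over a graded monoid `M` with weights in a strong topological
semiring `K`, their standard (position) automata and their derived-term automata.
-/

noncomputable section

namespace WExpr

universe u v

/-- A *strong* semiring: a (Hausdorff) topological semiring in which the product of two summable
families is a summable family. -/
class IsStrongSemiring (K : Type u) [Semiring K] [TopologicalSpace K] : Prop extends
    IsTopologicalSemiring K, T2Space K where
  summable_mul : ∀ {ι κ : Type} (x : ι → K) (y : κ → K), Summable x → Summable y →
    Summable (fun p : ι × κ => x p.1 * y p.2)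

/-- A *graded* monoid: there is an additive length which is positive on the elements different
from `1`, and every element has finitely many factorisations (so that the Cauchy product of
arbitrary series over the monoid is defined; this holds as soon as the graded monoid is finitely
generated, or is a free monoid). -/
class IsGradedMonoid (M : Type v) [Monoid M] : Prop where
  exists_length : ∃ len : M → ℕ, (∀ a b, len (a * b) = len a + len b) ∧ ∀ a, a ≠ 1 → 0 < len a
  finite_factorisations : ∀ m : M, {p : M × M | p.1 * p.2 = m}.Finite

/-! ### Starrable elements -/

section Star

variable {K : Type u} [Semiring K] [TopologicalSpace K]

/-- `k` is starrable if the family of its powers is summable. -/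
def Starrable (k : K) : Prop := Summable (fun n : ℕ => k ^ n)

/-- `k*`, the sum of all powers of `k` (meaningful if `k` is starrable). -/
def kstar (k : K) : K := ∑' n : ℕ, k ^ n

end Star

/-! ### Series, with the topology of simple convergence -/

/-- Series over `M` with coefficients in `K`: maps from `M` to `K`.  The (product) topology, the
zero, the addition and the summable families of `M → K` are the pointwise ones. -/
abbrev Series (K : Type u) (M : Type v) : Type (max u v) := M → K

namespace Series

variable {K : Type u} {M : Type v} [Semiring K] [Monoid M]

open Classical in
/-- The series `m`, for an element `m` of the monoid; `mono 1` is the unit series. -/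
def mono (m : M) : Series K M := fun x => if x = m then 1 else 0

/-- The Cauchy product of series. -/
def cauchy [IsGradedMonoid M] (s t : Series K M) : Series K M := fun m =>
  ∑ p ∈ (IsGradedMonoid.finite_factorisations m).toFinset, s p.1 * t p.2

/-- Powers of a series for the Cauchy product. -/
def pow [IsGradedMonoid M] (s : Series K M) : ℕ → Series K M
  | 0 => mono 1
  | n + 1 => cauchy (pow s n) s

/-- A series is starrable if the family of its powers is summable. -/
def Starrable [TopologicalSpace K] [IsGradedMonoid M] (s : Series K M) : Prop :=
  Summable (fun n : ℕ => pow s n)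

/-- The star of a series: the sum of its powers (meaningful if the series is starrable). -/
def star [TopologicalSpace K] [IsGradedMonoid M] (s : Series K M) : Series K M :=
  ∑' n : ℕ, pow s n

end Series

/-! ### Expressions -/

/-- Rational expressions over `M` with weights in `K` (`K`-expressions). -/
inductive Expr (K : Type u) (M : Type v) [Monoid M] : Type (max u v)
  | zero : Expr K M
  | one : Expr K M
  | atom (m : M) (hm : m ≠ 1) : Expr K M
  | lsmul (k : K) (E : Expr K M) : Expr K M
  | rsmul (E : Expr K M) (k : K) : Expr K M
  | add (E F : Expr K M) : Expr K M
  | mul (E F : Expr K M) : Expr K M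
  | star (E : Expr K M) : Expr K M

namespace Expr

variable {K : Type u} {M : Type v} [Semiring K] [TopologicalSpace K] [Monoid M]

/-- The constant term of an expression (meaningful if the expression is valid). -/
def constTerm : Expr K M → K
  | zero => 0
  | one => 1
  | atom _ _ => 0
  | lsmul k E => k * constTerm E
  | rsmul E k => constTerm E * k
  | add E F => constTerm E + constTerm F
  | mul E F => constTerm E * constTerm F
  | star E => kstar (constTerm E)

/-- An expression is valid if the constant term of every starred subexpression is starrable. -/
def Valid : Expr K M → Prop
  | zero => True
  | one => True
  | atom _ _ => True
  | lsmul _ E => Valid E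
  | rsmul E _ => Valid E
  | add E F => Valid E ∧ Valid F
  | mul E F => Valid E ∧ Valid F
  | star E => Valid E ∧ Starrable (constTerm E)

/-- The series denoted by an expression (meaningful if `SeriesDefined` holds). -/
def series [IsGradedMonoid M] : Expr K M → Series K M
  | zero => 0
  | one => Series.mono 1
  | atom m _ => Series.mono m
  | lsmul k E => fun x => k * series E x
  | rsmul E k => fun x => series E x * k
  | add E F => series E + series F
  | mul E F => Series.cauchy (series E) (series F)
  | star E => Series.star (series E)

/-- All the stars that occur in the definition of the series denoted by an expression exist. -/
def SeriesDefined [IsGradedMonoid M] : Expr K M → Prop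
  | zero => True
  | one => True
  | atom _ _ => True
  | lsmul _ E => SeriesDefined E
  | rsmul E _ => SeriesDefined E
  | add E F => SeriesDefined E ∧ SeriesDefined F
  | mul E F => SeriesDefined E ∧ SeriesDefined F
  | star E => SeriesDefined E ∧ Series.Starrable (series E)

end Expr

/-! ### Automata -/

/-- A finite `K`-automaton over `M` with (finite) set of states `Q`, in matrix form: an initial
row-vector, a final column-vector, and a transition matrix whose entries are finite linear
combinations of elements of `M` different from `1`. -/
structure Automaton (K : Type u) (M : Type v) [Semiring K] [Monoid M] (Q : Type*) where
  init : Q → K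
  trans : Matrix Q Q (MonoidAlgebra K M)
  final : Q → K
  proper : ∀ p q, (trans p q).coeff 1 = 0

/-- The amalgamation matrix of a map `φ`. -/
def amalgamation (K : Type u) [Semiring K] {Q R : Type*} (φ : Q → R) : Matrix Q R K :=
  open Classical in Matrix.of fun q r => if φ q = r then 1 else 0

namespace Automaton

variable {K : Type u} {M : Type v} [Semiring K] [Monoid M]

open Classical in
/-- The star of the transition matrix: the sum of its powers (coefficientwise). -/
def transStar [TopologicalSpace K] {Q : Type*} [Fintype Q] (A : Automaton K M Q) :
    Matrix Q Q (Series K M) :=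
  Matrix.of fun p q m => ∑' n : ℕ, ((A.trans ^ n) p q).coeff m

/-- The behaviour `I · E* · T` of an automaton. -/
def behaviour [TopologicalSpace K] {Q : Type*} [Fintype Q] (A : Automaton K M Q) :
    Series K M :=
  fun m => ∑ p, ∑ q, A.init p * A.transStar p q m * A.final q

/-- `A` is conjugate to `B` with transfer matrix `X`:  `I X = J`, `E X = X F`, `T = X U`.
(Scalars are seen as polynomials supported by `1` in the second equation.) -/
def ConjugateBy {Q R : Type*} [Fintype Q] [Fintype R] (A : Automaton K M Q)
    (B : Automaton K M R) (X : Matrix Q R K) : Prop :=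
  Matrix.vecMul A.init X = B.init ∧
  A.trans * X.map (MonoidAlgebra.singleOneRingHom : K →+* MonoidAlgebra K M) =
    X.map (MonoidAlgebra.singleOneRingHom : K →+* MonoidAlgebra K M) * B.trans ∧
  A.final = Matrix.mulVec X B.final

/-- A surjective map on states is a morphism from `A` onto `B` if `A` is conjugate to `B` by its
amalgamation matrix. -/
def IsMorphism {Q R : Type*} [Fintype Q] [Fintype R] (A : Automaton K M Q)
    (B : Automaton K M R) (φ : Q → R) : Prop :=
  Function.Surjective φ ∧ A.ConjugateBy B (amalgamation K φ)

/-- `B` is a quotient of `A` if there is a morphism from `A` onto `B`. -/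
def IsQuotient {Q R : Type*} [Fintype Q] [Fintype R] (B : Automaton K M R)
    (A : Automaton K M Q) : Prop :=
  ∃ φ : Q → R, A.IsMorphism B φ

open Classical in
/-- The image `⟨I X, Y E X, Y T⟩` of an automaton by a surjective map `φ`, where `X` is the
amalgamation matrix of `φ` and `Y` is a selection matrix (its row of index `r` selects one state
of the class of `r`).  It does not depend on the selection when `φ` is a morphism. -/
def image {Q R : Type*} [Fintype Q] (A : Automaton K M Q) (φ : Q → R)
    (hφ : Function.Surjective φ) : Automaton K M R where
  init r := ∑ q with φ q = r, A.init q
  trans := Matrix.of fun r r' => ∑ q with φ q = r', A.trans (Function.surjInv hφ r) q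
  final r := A.final (Function.surjInv hφ r)
  proper r r' := by
    simp [MonoidAlgebra.coeff_sum, A.proper]

end Automaton

/-! ### Standard automata and the operations on them -/

/-- A standard automaton of dimension `ι` in block form `⟨(1 0), (0 J; 0 F), (c; U)⟩`. -/
structure StdAut (K : Type u) (M : Type v) [Semiring K] [Monoid M] (ι : Type*) where
  c : K
  J : ι → MonoidAlgebra K M
  F : Matrix ι ι (MonoidAlgebra K M)
  U : ι → K
  properJ : ∀ q, (J q).coeff 1 = 0
  properF : ∀ p q, (F p q).coeff 1 = 0

namespace StdAut

variable {K : Type u} {M : Type v} [Semiring K] [Monoid M]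

/-- The automaton described by the block form; its initial state is `Sum.inl ()`. -/
def toAutomaton {ι : Type*} (A : StdAut K M ι) : Automaton K M (Unit ⊕ ι) where
  init := Sum.elim (fun _ => 1) (fun _ => 0)
  trans := Matrix.fromBlocks 0 (Matrix.of fun _ q => A.J q) 0 A.F
  final := Sum.elim (fun _ => A.c) A.U
  proper := by
    rintro (p | p) (q | q) <;> simp [A.properJ, A.properF]

/-- The one-state automaton with final weight `c` and no transition. -/
def const (c : K) : StdAut K M Empty where
  c := c
  J := Empty.elim
  F := 0
  U := Empty.elim
  properJ q := q.elim
  properF p := p.elim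

/-- The two-state automaton with a single transition, labelled by `m ≠ 1`; `ι` is a one-point
type. -/
def single (ι : Type*) (m : M) (hm : m ≠ 1) : StdAut K M ι where
  c := 0
  J _ := MonoidAlgebra.single m 1
  F := 0
  U _ := 1
  properJ _ := by simp [hm]
  properF _ _ := by simp

/-- `k A` -/
def lsmul {ι : Type*} (k : K) (A : StdAut K M ι) : StdAut K M ι where
  c := k * A.c
  J q := k • A.J q
  F := A.F
  U := A.U
  properJ q := by simp [A.properJ]
  properF := A.properF

/-- `A k` -/
def rsmul {ι : Type*} (A : StdAut K M ι) (k : K) : StdAut K M ι where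
  c := A.c * k
  J := A.J
  F := A.F
  U q := A.U q * k
  properJ := A.properJ
  properF := A.properF

/-- `A + B` -/
def add {ι κ : Type*} (A : StdAut K M ι) (B : StdAut K M κ) : StdAut K M (ι ⊕ κ) where
  c := A.c + B.c
  J := Sum.elim A.J B.J
  F := Matrix.fromBlocks A.F 0 0 B.F
  U := Sum.elim A.U B.U
  properJ := by rintro (q | q) <;> simp [A.properJ, B.properJ]
  properF := by rintro (p | p) (q | q) <;> simp [A.properF, B.properF]

/-- `A · B` -/
def mul {ι κ : Type*} (A : StdAut K M ι) (B : StdAut K M κ) : StdAut K M (ι ⊕ κ) where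
  c := A.c * B.c
  J := Sum.elim A.J (fun q => A.c • B.J q)
  F := Matrix.fromBlocks A.F (Matrix.of fun p q => A.U p • B.J q) 0 B.F
  U := Sum.elim (fun p => A.U p * B.c) B.U
  properJ := by rintro (q | q) <;> simp [A.properJ, B.properJ]
  properF := by rintro (p | p) (q | q) <;> simp [A.properF, B.properF, B.properJ]

/-- `A*` (meaningful if `A.c` is starrable) -/
def star [TopologicalSpace K] {ι : Type*} (A : StdAut K M ι) : StdAut K M ι where
  c := kstar A.c
  J q := kstar A.c • A.J q
  F := Matrix.of fun p q => (A.U p * kstar A.c) • A.J q + A.F p q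
  U q := A.U q * kstar A.c
  properJ q := by simp [A.properJ]
  properF p q := by simp [A.properJ, A.properF]

open Classical in
/-- The image of a standard automaton by a surjective map on its non-initial states (the initial
state being mapped to the initial state).  If the map is bijective, this is only a renaming of the
states. -/
def image {ι κ : Type*} [Fintype ι] (A : StdAut K M ι) (φ : ι → κ)
    (hφ : Function.Surjective φ) : StdAut K M κ where
  c := A.c
  J r := ∑ q with φ q = r, A.J q
  F := Matrix.of fun r r' => ∑ q with φ q = r', A.F (Function.surjInv hφ r) q
  U r := A.U (Function.surjInv hφ r)
  properJ r := by simp [MonoidAlgebra.coeff_sum, A.properJ]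
  properF r r' := by simp [MonoidAlgebra.coeff_sum, A.properF]

end StdAut

namespace Expr

section

variable {K : Type u} {M : Type v} [Semiring K] [TopologicalSpace K] [Monoid M]

/-! ### The position automaton of an expression -/

/-- The positions of an expression: the occurrences of its atoms. -/
def Pos : Expr K M → Type
  | zero => Empty
  | one => Empty
  | atom _ _ => Unit
  | lsmul _ E => Pos E
  | rsmul E _ => Pos E
  | add E F => Pos E ⊕ Pos F
  | mul E F => Pos E ⊕ Pos F
  | star E => Pos E

/-- An expression has finitely many positions. -/
@[reducible] def posFintype : (E : Expr K M) → Fintype (Pos E)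
  | zero => inferInstanceAs (Fintype Empty)
  | one => inferInstanceAs (Fintype Empty)
  | atom _ _ => inferInstanceAs (Fintype Unit)
  | lsmul _ E => posFintype E
  | rsmul E _ => posFintype E
  | add E F => @instFintypeSum _ _ (posFintype E) (posFintype F)
  | mul E F => @instFintypeSum _ _ (posFintype E) (posFintype F)
  | star E => posFintype E

instance (E : Expr K M) : Fintype (Pos E) := posFintype E

/-- The standard automaton (position automaton) of an expression, in block form. -/
def standard : (E : Expr K M) → StdAut K M (Pos E)
  | zero => StdAut.const 0
  | one => StdAut.const 1
  | atom m hm => StdAut.single Unit m hm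
  | lsmul k E => (standard E).lsmul k
  | rsmul E k => (standard E).rsmul k
  | add E F => (standard E).add (standard F)
  | mul E F => (standard E).mul (standard F)
  | star E => (standard E).star

/-- The standard automaton (position automaton) of an expression. -/
def positionAutomaton (E : Expr K M) : Automaton K M (Unit ⊕ Pos E) :=
  (standard E).toAutomaton

end

section

variable {K : Type u} {M : Type v} [Monoid M]

/-! ### The derived terms of an expression -/

open Classical in
/-- The (finite) set of derived terms of an expression. -/
def derTerms : Expr K M → Finset (Expr K M)
  | zero => ∅
  | one => ∅
  | atom _ _ => {one}
  | lsmul _ F => derTerms F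
  | rsmul F k => (derTerms F).image (fun H => rsmul H k)
  | add F G => derTerms F ∪ derTerms G
  | mul F G => (derTerms F).image (fun H => mul H G) ∪ derTerms G
  | star F => (derTerms F).image (fun H => mul H (star F))

/-- The derived terms of an expression, as a type. -/
abbrev Der (E : Expr K M) : Type (max u v) := {H : Expr K M // H ∈ derTerms E}

/-- The renaming `H ↦ H k` of the derived terms of `F` into those of `F k`. -/
def derRsmul (F : Expr K M) (k : K) (H : Der F) : Der (rsmul F k) :=
  ⟨rsmul H.1 k, by classical exact Finset.mem_image_of_mem _ H.2⟩

/-- The renaming `H ↦ H · F*` of the derived terms of `F` into those of `F*`. -/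
def derStar (F : Expr K M) (H : Der F) : Der (star F) :=
  ⟨mul H.1 (star F), by classical exact Finset.mem_image_of_mem _ H.2⟩

/-- The natural map from the disjoint union of the derived terms of `F` and `G` onto the derived
terms of `F + G`: it merges two terms if they are equal. -/
def derAdd (F G : Expr K M) : Der F ⊕ Der G → Der (add F G) :=
  Sum.elim (fun H => ⟨H.1, by classical exact Finset.mem_union_left _ H.2⟩)
    (fun H => ⟨H.1, by classical exact Finset.mem_union_right _ H.2⟩)

/-- The natural map from the disjoint union of the derived terms of `F`, multiplied by `G`, and of
the derived terms of `G` onto the derived terms of `F · G`: it merges two terms if they are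
equal. -/
def derMul (F G : Expr K M) : Der F ⊕ Der G → Der (mul F G) :=
  Sum.elim
    (fun H => ⟨mul H.1 G, by
      classical exact Finset.mem_union_left _ (Finset.mem_image_of_mem _ H.2)⟩)
    (fun H => ⟨H.1, by classical exact Finset.mem_union_right _ H.2⟩)

theorem derRsmul_surjective (F : Expr K M) (k : K) : Function.Surjective (derRsmul F k) := by
  classical
  rintro ⟨H, hH⟩
  obtain ⟨L, hL, rfl⟩ := Finset.mem_image.1 hH
  exact ⟨⟨L, hL⟩, rfl⟩

theorem derStar_surjective (F : Expr K M) : Function.Surjective (derStar F) := by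
  classical
  rintro ⟨H, hH⟩
  obtain ⟨L, hL, rfl⟩ := Finset.mem_image.1 hH
  exact ⟨⟨L, hL⟩, rfl⟩

theorem derAdd_surjective (F G : Expr K M) : Function.Surjective (derAdd F G) := by
  classical
  rintro ⟨H, hH⟩
  rcases Finset.mem_union.1 hH with h | h
  · exact ⟨Sum.inl ⟨H, h⟩, rfl⟩
  · exact ⟨Sum.inr ⟨H, h⟩, rfl⟩

theorem derMul_surjective (F G : Expr K M) : Function.Surjective (derMul F G) := by
  classical
  rintro ⟨H, hH⟩
  rcases Finset.mem_union.1 hH with h | h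
  · obtain ⟨L, hL, rfl⟩ := Finset.mem_image.1 h
    exact ⟨Sum.inl ⟨L, hL⟩, rfl⟩
  · exact ⟨Sum.inr ⟨H, h⟩, rfl⟩

open Classical in
/-- The states of the derived-term automaton: `E` itself and the derived terms of `E`. -/
abbrev DState (E : Expr K M) : Type (max u v) := {H : Expr K M // H ∈ insert E (derTerms E)}

/-- The natural map from the states of the standard derived-term automaton, the initial state
being indexed by `E`, to the set of expressions they are indexed by.  If `E` is a derived term of
`E`, it merges the initial state with the state `E`; otherwise it is a bijection. -/
def omega (E : Expr K M) : Unit ⊕ Der E → DState E :=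
  Sum.elim (fun _ => ⟨E, by classical exact Finset.mem_insert_self _ _⟩)
    (fun H => ⟨H.1, by classical exact Finset.mem_insert_of_mem H.2⟩)

theorem omega_surjective (E : Expr K M) : Function.Surjective (omega E) := by
  classical
  rintro ⟨H, hH⟩
  rcases Finset.mem_insert.1 hH with rfl | h
  · exact ⟨Sum.inl (), rfl⟩
  · exact ⟨Sum.inr ⟨H, h⟩, rfl⟩

end

section

variable {K : Type u} {M : Type v} [Semiring K] [TopologicalSpace K] [Monoid M]

/-! ### The standard derived-term automaton and the derived-term automaton -/

/-- The standard derived-term automaton of an expression, in block form. -/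
def term : (E : Expr K M) → StdAut K M (Der E)
  | zero => (StdAut.const 0).image Empty.elim (fun H => by simpa [derTerms] using H.2)
  | one => (StdAut.const 1).image Empty.elim (fun H => by simpa [derTerms] using H.2)
  | atom m hm => StdAut.single _ m hm
  | lsmul k F => (term F).lsmul k
  | rsmul F k => ((term F).rsmul k).image (derRsmul F k) (derRsmul_surjective F k)
  | add F G => ((term F).add (term G)).image (derAdd F G) (derAdd_surjective F G)
  | mul F G => ((term F).mul (term G)).image (derMul F G) (derMul_surjective F G)
  | star F => (term F).star.image (derStar F) (derStar_surjective F)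

/-- The standard derived-term automaton of an expression; its states are the initial state and the
derived terms. -/
def termAutomaton (E : Expr K M) : Automaton K M (Unit ⊕ Der E) :=
  (term E).toAutomaton

/-- The derived-term automaton of an expression: the image of the standard derived-term automaton
by `omega` (which is this automaton itself, with its initial state named `E`, if `E` is not a
derived term of `E`). -/
def derivedTermAutomaton (E : Expr K M) : Automaton K M (DState E) :=
  (termAutomaton E).image (omega E) (omega_surjective E)

end

end Expr

end WExpr

end

/-! The derivative `Expr.deriv` is a formal linear combination of expressions with polynomial
coefficients. Label the states of an automaton by expressions, and ask that the transitions leaving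
a state, collected by the label of their target, give the derivative of its label, its final weight
being the constant term of that label (`Represents`). The operations on standard automata copy the
rules for derivatives and constant terms, so position automata and standard derived-term automata
both have this property, and merging states with equal labels preserves it. In the derived-term
automaton distinct states have distinct labels, so comparing coefficients label by label gives `E X
= X F` (`Automaton.Represents.isMorphism`). Both morphisms come from this one argument, whatever
values the stars have.

For the behaviour, a valid expression satisfies |E| = c(E)·1 + (value of its derivative)
(`seriesDefined_and_series_eq`). The star is the analytic case: if s = c·1 + L with L proper, then
s^(n+1) = c s^n + L s^n, and at m the last term involves s^n only on elements shorter than m.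
Induction on length and a product of summable families in K give the existence of s* and s* = c*(1 +
L s*). The series of the states of the derived-term automaton therefore solve its linear system; as
its matrix is proper, iterating the system shows that the solution is E*T. The behaviour is thus
computed directly, without transporting it along the quotient. -/

namespace WExpr

/-! ### Summable families in a strong semiring -/

open Filter Finset in
/-- In a Hausdorff topological semiring, the product of two sums is the sum of the family of
products, if the latter is summable. -/
theorem hasSum_mul_of_summable {K : Type*} [Semiring K] [TopologicalSpace K]
    [IsTopologicalSemiring K] [T2Space K] {ι κ : Type*} {x : ι → K} {y : κ → K} {a b : K}
    (hx : HasSum x a) (hy : HasSum y b) (hxy : Summable fun p : ι × κ => x p.1 * y p.2) :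
    HasSum (fun p : ι × κ => x p.1 * y p.2) (a * b) := by
  classical
  obtain ⟨c, hc⟩ := hxy
  have h₁ : Tendsto (fun s : Finset ι × Finset κ => ∑ p ∈ s.1 ×ˢ s.2, x p.1 * y p.2)
      (atTop ×ˢ atTop) (nhds (a * b)) := by
    have hx' : Tendsto (fun s : Finset ι => ∑ i ∈ s, x i) atTop (nhds a) := by
      simpa [HasSum] using hx
    have hy' : Tendsto (fun s : Finset κ => ∑ i ∈ s, y i) atTop (nhds b) := by
      simpa [HasSum] using hy
    refine ((hx'.comp tendsto_fst).mul (hy'.comp tendsto_snd)).congr fun s => ?_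
    simp [Finset.sum_mul_sum, Finset.sum_product]
  have h₂ : Tendsto (fun s : Finset (ι × κ) => ∑ p ∈ s, x p.1 * y p.2) atTop (nhds c) := by
    simpa [HasSum] using hc
  -- Rectangles are cofinal among the finite subsets of `ι × κ`, so `c` and `a * b` are both limits
  -- of the rectangular partial sums.
  have h₃ := h₂.comp tendsto_finsetProd_atTop
  rw [prod_atTop_atTop_eq] at h₁
  rwa [tendsto_nhds_unique h₁ h₃]

open Filter Finset in
/-- Summation along the antidiagonals of `ℕ × ℕ`. -/
theorem hasSum_antidiagonal {K : Type*} [AddCommMonoid K] [TopologicalSpace K]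
    {f : ℕ × ℕ → K} {a : K} (hf : HasSum f a) :
    HasSum (fun n => ∑ p ∈ HasAntidiagonal.antidiagonal n, f p) a := by
  have h : Tendsto (fun s : Finset (ℕ × ℕ) => ∑ p ∈ s, f p) atTop (nhds a) := by
    simpa [HasSum] using hf
  -- Antidiagonals are finite and cover `ℕ × ℕ`, so sums over finite unions of them form a subnet of
  -- the partial sums of `f`; no regularity of the topology is needed.
  have key : Tendsto (fun s : Finset ℕ => s.biUnion fun n => HasAntidiagonal.antidiagonal n) atTop atTop := by
    refine tendsto_atTop_finset_of_monotone (fun s t hst => biUnion_subset_biUnion_of_subset_left _ hst) ?_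
    exact fun p => ⟨{p.1 + p.2}, by simp⟩
  have := h.comp key
  simp only [HasSum, SummationFilter.unconditional_filter]
  refine this.congr fun s => ?_
  refine sum_biUnion fun i _ j _ hij => ?_
  rw [Function.onFun, disjoint_left]
  intro p hp hq
  exact hij ((mem_antidiagonal.1 hp).symm.trans (mem_antidiagonal.1 hq))

/-- Unrolling the recurrence shows that `a` is the convolution of the powers of `c` with the
sequence `a 0, b 0, b 1, …`. The strong hypothesis makes the double family summable, and summing it
along antidiagonals gives the value. -/
theorem hasSum_of_linear_recurrence {K : Type*} [Semiring K] [TopologicalSpace K]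
    [IsStrongSemiring K] {c β : K} {a b : ℕ → K} (hc : Starrable c) (hb : HasSum b β)
    (h : ∀ n, a (n + 1) = c * a n + b n) : HasSum a (kstar c * (a 0 + β)) := by
  let b' : ℕ → K := fun n => Nat.casesOn n (a 0) b
  have hb' : HasSum b' (a 0 + β) := HasSum.zero_add (f := b') hb
  have hprod : HasSum (fun p : ℕ × ℕ => c ^ p.1 * b' p.2) (kstar c * (a 0 + β)) :=
    hasSum_mul_of_summable hc.hasSum hb'
      (IsStrongSemiring.summable_mul _ _ hc hb'.summable)
  convert hasSum_antidiagonal hprod using 2 with n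
  induction n with
  | zero => simp [b']
  | succ n ih =>
    -- The pair `(0, n + 1)` that is split off contributes `b n`; every other term contains a factor
    -- `c` on the left.
    rw [h, ih, Finset.Nat.antidiagonal_succ, Finset.sum_cons, Finset.sum_map, Finset.mul_sum,
      add_comm]
    simp [b', _root_.pow_succ', mul_assoc]

/-! ### Cauchy product and star of series -/

namespace Series

variable {K M : Type*} [Semiring K] [Monoid M] [IsGradedMonoid M]

theorem mem_factorisations {m : M} {p : M × M} :
    p ∈ (IsGradedMonoid.finite_factorisations m).toFinset ↔ p.1 * p.2 = m := by simp

theorem cauchy_apply (s t : Series K M) (m : M) : cauchy s t m =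
    ∑ p ∈ (IsGradedMonoid.finite_factorisations m).toFinset, s p.1 * t p.2 := rfl

theorem cauchy_add_left (s s' t : Series K M) :
    cauchy (s + s') t = cauchy s t + cauchy s' t := by
  ext m; simp [cauchy_apply, add_mul, Finset.sum_add_distrib]

theorem cauchy_add_right (s t t' : Series K M) :
    cauchy s (t + t') = cauchy s t + cauchy s t' := by
  ext m; simp [cauchy_apply, mul_add, Finset.sum_add_distrib]

theorem cauchy_zero_left (t : Series K M) : cauchy 0 t = 0 := by
  ext m; simp [cauchy_apply]

theorem cauchy_zero_right (s : Series K M) : cauchy s 0 = 0 := by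
  ext m; simp [cauchy_apply]

theorem cauchy_sum_left {ι : Type*} (I : Finset ι) (s : ι → Series K M) (t : Series K M) :
    cauchy (∑ i ∈ I, s i) t = ∑ i ∈ I, cauchy (s i) t := by
  classical
  induction I using Finset.induction_on with
  | empty => simp [cauchy_zero_left]
  | insert i I hi ih => simp [Finset.sum_insert hi, cauchy_add_left, ih]

theorem cauchy_sum_right {ι : Type*} (I : Finset ι) (s : Series K M) (t : ι → Series K M) :
    cauchy s (∑ i ∈ I, t i) = ∑ i ∈ I, cauchy s (t i) := by
  classical
  induction I using Finset.induction_on with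
  | empty => simp [cauchy_zero_right]
  | insert i I hi ih => simp [Finset.sum_insert hi, cauchy_add_right, ih]

theorem cauchy_smul_left (k : K) (s t : Series K M) : cauchy (k • s) t = k • cauchy s t := by
  ext m; simp [cauchy_apply, mul_assoc, Finset.mul_sum]

/-- As `K` need not be commutative, multiplication by `k` on the right is written as the action of
`MulOpposite.op k`. -/
theorem cauchy_op_smul_right (k : K) (s t : Series K M) :
    cauchy s (MulOpposite.op k • t) = MulOpposite.op k • cauchy s t := by
  ext m; simp [cauchy_apply, mul_assoc, Finset.sum_mul]

theorem one_cauchy (s : Series K M) : cauchy (mono 1) s = s := by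
  ext m
  rw [cauchy_apply, Finset.sum_eq_single (1, m)]
  · simp [mono]
  · rintro ⟨a, b⟩ hp hne
    rw [mem_factorisations] at hp
    rw [mono, if_neg, zero_mul]
    rintro rfl
    exact hne (by simpa using hp)
  · simp

theorem cauchy_one (s : Series K M) : cauchy s (mono 1) = s := by
  ext m
  rw [cauchy_apply, Finset.sum_eq_single (m, 1)]
  · simp [mono]
  · rintro ⟨a, b⟩ hp hne
    rw [mem_factorisations] at hp
    rw [mono, if_neg, mul_zero]
    rintro rfl
    exact hne (by simpa using hp)
  · simp

theorem cauchy_smul_one_apply (k : K) (s : Series K M) (m : M) :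
    cauchy s (k • mono 1) m = s m * k := by
  have : (k • mono 1 : Series K M) = MulOpposite.op k • mono 1 := by
    ext m; simp [mono]
  rw [this, cauchy_op_smul_right, cauchy_one]; rfl

theorem cauchy_assoc (s t u : Series K M) : cauchy (cauchy s t) u = cauchy s (cauchy t u) := by
  ext m
  simp only [cauchy_apply, Finset.sum_mul, Finset.mul_sum, Finset.sum_sigma']
  -- Both sides are sums over the triples with product `m`; the bijection changes their bracketing.
  refine Finset.sum_nbij' (fun x => ⟨(x.2.1, x.2.2 * x.1.2), (x.2.2, x.1.2)⟩)
    (fun x => ⟨(x.1.1 * x.2.1, x.2.2), (x.1.1, x.2.1)⟩) ?_ ?_ ?_ ?_ ?_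
  · rintro ⟨⟨a, b⟩, ⟨a', b'⟩⟩ h
    simp only [Finset.mem_sigma, mem_factorisations] at h ⊢
    simp [← h.1, ← h.2, mul_assoc]
  · rintro ⟨⟨a, b⟩, ⟨a', b'⟩⟩ h
    simp only [Finset.mem_sigma, mem_factorisations] at h ⊢
    simp [← h.1, ← h.2, mul_assoc]
  · rintro ⟨⟨a, b⟩, ⟨a', b'⟩⟩ h
    simp only [Finset.mem_sigma, mem_factorisations] at h
    simp [h.2]
  · rintro ⟨⟨a, b⟩, ⟨a', b'⟩⟩ h
    simp only [Finset.mem_sigma, mem_factorisations] at h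
    simp [h.2]
  · simp [mul_assoc]

theorem coeff_mul (a b : MonoidAlgebra K M) :
    ((a * b).coeff : Series K M) = cauchy a.coeff b.coeff := by
  ext m
  exact MonoidAlgebra.coeff_mul_antidiag a b m _ mem_factorisations

theorem pow_succ' (s : Series K M) (n : ℕ) : pow s (n + 1) = cauchy s (pow s n) := by
  induction n with
  | zero => simp [pow, one_cauchy, cauchy_one]
  | succ n ih =>
    calc pow s (n + 2) = cauchy (cauchy s (pow s n)) s := by rw [← ih]; rfl
      _ = cauchy s (pow s (n + 1)) := cauchy_assoc _ _ _

/-- An additive length: the right factor of a product is strictly shorter than the product unless the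
left factor is `1`, and only `1` divides `1`. -/
theorem exists_length (M : Type*) [Monoid M] [IsGradedMonoid M] :
    ∃ len : M → ℕ, ∀ a b, len (a * b) = len a + len b ∧ (a ≠ 1 → len b < len (a * b)) ∧
      (a * b = 1 → a = 1) := by
  obtain ⟨len, hmul, hpos⟩ := IsGradedMonoid.exists_length (M := M)
  have h1 : len 1 = 0 := by have := hmul 1 1; rw [mul_one] at this; omega
  refine ⟨len, fun a b => ⟨hmul a b, fun ha => by have := hpos a ha; rw [hmul]; omega,
    fun hab => ?_⟩⟩
  by_contra ha
  have := hpos a ha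
  have := hmul a b
  rw [hab] at this
  omega

/-- By additivity of the length, `1` is the only left factor of `1`. -/
theorem cauchy_apply_one_of_proper {s : Series K M} (hs : s 1 = 0) (t : Series K M) :
    cauchy s t 1 = 0 := by
  obtain ⟨len, hlen⟩ := exists_length M
  refine Finset.sum_eq_zero fun p hp => ?_
  rw [(hlen p.1 p.2).2.2 (mem_factorisations.1 hp), hs, zero_mul]

/-- The star of a series whose constant term is starrable exists, and it is a solution of the
expected equation. -/
theorem starrable_and_star_eq [TopologicalSpace K] [IsStrongSemiring K] {c : K}
    (hc : WExpr.Starrable c) {L s : Series K M} (hL : L 1 = 0) (hs : s = c • mono 1 + L) :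
    Starrable s ∧ star s = kstar c • (mono 1 + cauchy L (star s)) := by
  obtain ⟨len, hlen⟩ := exists_length M
  have hrec (m : M) (n : ℕ) : pow s (n + 1) m = c * pow s n m + cauchy L (pow s n) m := by
    rw [pow_succ']
    nth_rw 1 [hs]
    rw [cauchy_add_left, cauchy_smul_left, one_cauchy]; rfl
  have hsum (m : M) : Summable fun n => pow s n m := by
    induction hm : len m using Nat.strong_induction_on generalizing m with
    | _ N ih =>
      subst hm
      have hb : Summable fun n => cauchy L (pow s n) m := by
        -- A factorisation with left factor `1` is killed by `L 1 = 0`; in any other one the right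
        -- factor is shorter than `m`.
        refine summable_sum fun p hp => ?_
        by_cases h1 : p.1 = 1
        · simp [h1, hL]
        · refine (ih (len p.2) ?_ p.2 rfl).mul_left _
          exact mem_factorisations.1 hp ▸ (hlen p.1 p.2).2.1 h1
      exact (hasSum_of_linear_recurrence hc hb.hasSum (hrec m)).summable
  have hstar : Starrable s := Pi.summable.2 hsum
  have happly (m : M) : HasSum (fun n => pow s n m) (star s m) :=
    Pi.hasSum.1 hstar.hasSum m
  refine ⟨hstar, ?_⟩
  ext m
  have hb : HasSum (fun n => cauchy L (pow s n) m) (cauchy L (star s) m) :=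
    hasSum_sum fun p _ => (happly p.2).mul_left _
  -- The initial term of the recurrence is `pow s 0 = mono 1`, which gives the unit series in the
  -- equation.
  exact (happly m).unique (hasSum_of_linear_recurrence hc hb (hrec m))

end Series

end WExpr

/-! ### Derivatives, and automata labelled by expressions -/

noncomputable section

namespace WExpr

open Finsupp in
/-- The total derivative of an expression: the formal linear combination of its derived terms, with
polynomial coefficients, given by its first transitions. -/
def Expr.deriv {K M : Type*} [Semiring K] [TopologicalSpace K] [Monoid M] :
    Expr K M → (Expr K M →₀ MonoidAlgebra K M)
  | .zero => 0
  | .one => 0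
  | .atom m _ => single .one (MonoidAlgebra.single m 1)
  | .lsmul k F => k • deriv F
  | .rsmul F k => mapDomain (fun H => .rsmul H k) (deriv F)
  | .add F G => deriv F + deriv G
  | .mul F G => mapDomain (fun H => .mul H G) (deriv F) + constTerm F • deriv G
  | .star F => kstar (constTerm F) • mapDomain (fun H => .mul H (.star F)) (deriv F)

section SumSingle

variable {ι κ X A : Type*} [Fintype ι] [AddCommMonoid A]

theorem mapDomain_sum_single (φ : X → X) (a : ι → A) (f : ι → X) :
    ∑ q, Finsupp.single (φ (f q)) (a q) =
      Finsupp.mapDomain φ (∑ q, Finsupp.single (f q) (a q)) := by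
  simp [Finsupp.mapDomain_finsetSum, Finsupp.mapDomain_single]

theorem smul_sum_single {R : Type*} [Semiring R] [Module R A] (k : R) (a : ι → A) (f : ι → X) :
    ∑ q, Finsupp.single (f q) (k • a q) = k • ∑ q, Finsupp.single (f q) (a q) := by
  simp [Finset.smul_sum]

-- Adding up the transitions into a class does not change the linear combination of their labels
-- when the labels are constant on classes. This is why representation passes to images.
open Classical in
theorem sum_single_fiberwise [Fintype κ] (φ : ι → κ) (g : κ → X) (a : ι → A) :
    ∑ r, Finsupp.single (g r) (∑ q with φ q = r, a q) = ∑ q, Finsupp.single (g (φ q)) (a q) := by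
  rw [← Finset.sum_fiberwise (g := φ)]
  refine Finset.sum_congr rfl fun r _ => ?_
  rw [← Finsupp.singleAddHom_apply, map_sum]
  refine Finset.sum_congr rfl fun q hq => ?_
  rw [(Finset.mem_filter.1 hq).2, Finsupp.singleAddHom_apply]

end SumSingle

variable {K M : Type*} [Semiring K] [TopologicalSpace K] [Monoid M]

/-- The states of `A` can be labelled by expressions, by means of `f`, so that the transitions and
the final weight of every state are given by the derivative and the constant term of its label. -/
structure Automaton.Represents {Q : Type*} [Fintype Q] (A : Automaton K M Q) (f : Q → Expr K M) :
    Prop where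
  trans : ∀ p, ∑ q, Finsupp.single (f q) (A.trans p q) = (f p).deriv
  final : ∀ p, A.final p = (f p).constTerm

/-- `Automaton.Represents` for a standard automaton, the initial state being labelled by `E`. -/
structure StdAut.Represents {ι : Type*} [Fintype ι] (A : StdAut K M ι) (E : Expr K M)
    (f : ι → Expr K M) : Prop where
  c : A.c = E.constTerm
  J : ∑ q, Finsupp.single (f q) (A.J q) = E.deriv
  F : ∀ p, ∑ q, Finsupp.single (f q) (A.F p q) = (f p).deriv
  U : ∀ p, A.U p = (f p).constTerm

namespace StdAut.Represents

variable {ι κ : Type*} [Fintype ι] [Fintype κ] {A : StdAut K M ι} {B : StdAut K M κ}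
  {E E' : Expr K M} {f : ι → Expr K M} {g : κ → Expr K M}

theorem lsmul (h : A.Represents E f) (k : K) : (A.lsmul k).Represents (.lsmul k E) f where
  c := by simp [StdAut.lsmul, Expr.constTerm, h.c]
  J := by simp only [StdAut.lsmul, smul_sum_single, h.J, Expr.deriv]
  F := h.F
  U := h.U

theorem rsmul (h : A.Represents E f) (k : K) :
    (A.rsmul k).Represents (.rsmul E k) (fun p => .rsmul (f p) k) where
  c := by simp [StdAut.rsmul, Expr.constTerm, h.c]
  J := by
    rw [Expr.deriv, ← h.J]; exact mapDomain_sum_single (fun H => .rsmul H k) A.J f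
  F p := by
    rw [Expr.deriv, ← h.F]; exact mapDomain_sum_single (fun H => .rsmul H k) (A.F p) f
  U p := by simp [StdAut.rsmul, Expr.constTerm, h.U]

theorem add (hA : A.Represents E f) (hB : B.Represents E' g) :
    (A.add B).Represents (.add E E') (Sum.elim f g) where
  c := by simp [StdAut.add, Expr.constTerm, hA.c, hB.c]
  J := by simp [StdAut.add, Expr.deriv, hA.J, hB.J]
  F := by rintro (p | p) <;> simp [StdAut.add, hA.F, hB.F]
  U := by rintro (p | p) <;> simp [StdAut.add, hA.U, hB.U]

/-- The new transitions `A.U p • B.J q` supply the second term of the product rule for the label `f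
p · E'`, since `A.U p` is the constant term of `f p`. -/
theorem mul (hA : A.Represents E f) (hB : B.Represents E' g) :
    (A.mul B).Represents (.mul E E') (Sum.elim (fun p => .mul (f p) E') g) where
  c := by simp [StdAut.mul, Expr.constTerm, hA.c, hB.c]
  J := by
    simp only [StdAut.mul, Expr.deriv, Fintype.sum_sum_type, Sum.elim_inl, Sum.elim_inr,
      smul_sum_single, hB.J, hA.c, mapDomain_sum_single (fun H => Expr.mul H E'), hA.J]
  F := by
    rintro (p | p)
    · simp only [StdAut.mul, Expr.deriv, Fintype.sum_sum_type, Sum.elim_inl, Sum.elim_inr,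
        Matrix.fromBlocks_apply₁₁, Matrix.fromBlocks_apply₁₂, Matrix.of_apply,
        smul_sum_single, hB.J, hA.U, mapDomain_sum_single (fun H => Expr.mul H E'), hA.F]
    · simp [StdAut.mul, hB.F]
  U := by rintro (p | p) <;> simp [StdAut.mul, hA.U, hB.U, hB.c, Expr.constTerm]

/-- The product rule for `f p · E*` adds to the transitions of `A` the derivative of `E*` weighted
by the constant term of `f p`, that is, the loops `U c* J`. -/
theorem star (h : A.Represents E f) :
    A.star.Represents (.star E) (fun p => .mul (f p) (.star E)) where
  c := by simp [StdAut.star, Expr.constTerm, h.c]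
  J := by
    simp only [StdAut.star, Expr.deriv, smul_sum_single,
      mapDomain_sum_single (fun H => Expr.mul H E.star), h.J, h.c,
      Finsupp.mapDomain_smul]
  F p := by
    simp only [StdAut.star, Expr.deriv, smul_sum_single, Matrix.of_apply, Finsupp.single_add,
      Finset.sum_add_distrib, mapDomain_sum_single (fun H => Expr.mul H E.star), h.J, h.F, h.c,
      h.U, Finsupp.mapDomain_smul, smul_smul]
    rw [add_comm]
  U p := by simp [StdAut.star, Expr.constTerm, h.U, h.c]

/-- The row of a state is constrained only through its label, and every state in the class of `r`
has label `g r`; so the selected representative is immaterial. -/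
theorem image {φ : ι → κ} (hφ : Function.Surjective φ) (h : A.Represents E (g ∘ φ)) :
    (A.image φ hφ).Represents E g := by
  have hs (r : κ) : φ (Function.surjInv hφ r) = r := Function.surjInv_eq hφ r
  refine ⟨h.c, ?_, fun r => ?_, fun r => ?_⟩
  · rw [← h.J]; exact sum_single_fiberwise φ g A.J
  · have := h.F (Function.surjInv hφ r)
    rw [Function.comp_apply, hs] at this
    rw [← this]
    exact sum_single_fiberwise φ g (A.F (Function.surjInv hφ r))
  · have := h.U (Function.surjInv hφ r)
    rwa [Function.comp_apply, hs] at this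

theorem toAutomaton (h : A.Represents E f) :
    A.toAutomaton.Represents (Sum.elim (fun _ => E) f) where
  trans := by rintro (p | p) <;> simp [StdAut.toAutomaton, h.J, h.F]
  final := by rintro (p | p) <;> simp [StdAut.toAutomaton, h.c, h.U]

end StdAut.Represents

theorem StdAut.represents_const_zero (f : Empty → Expr K M) :
    (StdAut.const (M := M) (0 : K)).Represents .zero f :=
  ⟨rfl, by simp [Expr.deriv], fun p => p.elim, fun p => p.elim⟩

theorem StdAut.represents_const_one (f : Empty → Expr K M) :
    (StdAut.const (M := M) (1 : K)).Represents .one f :=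
  ⟨rfl, by simp [Expr.deriv], fun p => p.elim, fun p => p.elim⟩

theorem StdAut.represents_single {ι : Type*} [Fintype ι] [Unique ι] {m : M} (hm : m ≠ 1)
    {f : ι → Expr K M} (hf : ∀ p, f p = .one) :
    (StdAut.single ι m hm).Represents (.atom m hm) f :=
  ⟨rfl, by simp [StdAut.single, Expr.deriv, hf], by simp [StdAut.single, Expr.deriv, hf],
    by simp [StdAut.single, Expr.constTerm, hf]⟩

namespace Automaton

variable {Q R : Type*} [Fintype Q] [Fintype R]

theorem Represents.image {A : Automaton K M Q} {φ : Q → R} {g : R → Expr K M}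
    (hφ : Function.Surjective φ) (h : A.Represents (g ∘ φ)) :
    (A.image φ hφ).Represents g := by
  have hs (r : R) : φ (Function.surjInv hφ r) = r := Function.surjInv_eq hφ r
  refine ⟨fun r => ?_, fun r => ?_⟩
  · have := h.trans (Function.surjInv hφ r)
    rw [Function.comp_apply, hs] at this
    rw [← this]
    exact sum_single_fiberwise φ g (A.trans (Function.surjInv hφ r))
  · have := h.final (Function.surjInv hφ r)
    rwa [Function.comp_apply, hs] at this

/-- If the labels of two automata are compatible with a surjective map and distinct states of the
second one have distinct labels, then the map is a morphism. -/
theorem Represents.isMorphism {A : Automaton K M Q} {B : Automaton K M R} {φ : Q → R}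
    {g : R → Expr K M} (hA : A.Represents (g ∘ φ)) (hB : B.Represents g)
    (hg : Function.Injective g) (hφ : Function.Surjective φ)
    (hinit : Matrix.vecMul A.init (amalgamation K φ) = B.init) : A.IsMorphism B φ := by
  classical
  refine ⟨hφ, hinit, ?_, ?_⟩
  · ext1 q r
    -- The rows of `q` and `φ q` both give the derivative of their common label. At the coefficient
    -- of `g r`, injectivity of `g` leaves the transitions of `A` into the class of `r` on one side
    -- and the single entry of `B` on the other.
    have h := DFunLike.congr_fun ((hA.trans q).trans (hB.trans (φ q)).symm) (g r)
    simp only [Finsupp.finsetSum_apply, Function.comp_apply, Finsupp.single_apply,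
      hg.eq_iff, Finset.sum_ite_eq', Finset.mem_univ, if_true] at h
    simp only [Matrix.mul_apply, amalgamation, Matrix.map_apply, Matrix.of_apply,
      apply_ite (MonoidAlgebra.singleOneRingHom : K →+* MonoidAlgebra K M), map_one, map_zero,
      mul_ite, ite_mul, mul_one, mul_zero, one_mul, zero_mul, Finset.sum_ite_eq,
      Finset.mem_univ, if_true]
    exact h
  · ext q
    simp [Matrix.mulVec, dotProduct, amalgamation, hA.final, hB.final]

end Automaton

theorem StdAut.vecMul_init {K M : Type*} [Semiring K] [Monoid M] {ι R : Type*} [Fintype ι] (A : StdAut K M ι) (φ : Unit ⊕ ι → R) :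
    Matrix.vecMul A.toAutomaton.init (amalgamation K φ) =
      fun r => amalgamation K φ (Sum.inl ()) r := by
  ext r
  simp [Matrix.vecMul, dotProduct, StdAut.toAutomaton]

/-! ### Position and derived-term automata, and the morphisms -/

namespace Expr

/-- The derived term which labels a position. -/
def posTerm {K M : Type*} [Monoid M] : (E : Expr K M) → Pos E → Expr K M
  | zero => Empty.elim
  | one => Empty.elim
  | atom _ _ => fun _ => one
  | lsmul _ F => posTerm F
  | rsmul F k => fun p => rsmul (posTerm F p) k
  | add F G => Sum.elim (posTerm F) (posTerm G)
  | mul F G => Sum.elim (fun p => mul (posTerm F p) G) (posTerm G)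
  | star F => fun p => mul (posTerm F p) (star F)

/-- One direction makes the map from positions to derived terms well defined, the other makes it
surjective. -/
theorem mem_derTerms_iff_posTerm {K M : Type*} [Monoid M] (E H : Expr K M) : H ∈ derTerms E ↔ ∃ p, posTerm E p = H := by
  induction E generalizing H with
  | zero => simp [derTerms, Pos]
  | one => simp [derTerms, Pos]
  | atom m hm => simpa [derTerms, posTerm, Pos] using eq_comm
  | lsmul k F ih => exact ih H
  | rsmul F k ih => simp [derTerms, posTerm, Pos, ih]
  | add F G ihF ihG => simp [derTerms, posTerm, Pos, ihF, ihG]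
  | mul F G ihF ihG => simp [derTerms, posTerm, Pos, ihF, ihG]
  | star F ih => simp [derTerms, posTerm, Pos, ih]

theorem standard_represents (E : Expr K M) : (standard E).Represents E (posTerm E) := by
  induction E with
  | zero => exact StdAut.represents_const_zero _
  | one => exact StdAut.represents_const_one _
  | atom m hm =>
    exact StdAut.represents_single (ι := Unit) hm fun _ => rfl
  | lsmul k F ih => exact ih.lsmul k
  | rsmul F k ih => exact ih.rsmul k
  | add F G ihF ihG => exact ihF.add ihG
  | mul F G ihF ihG => exact ihF.mul ihG
  | star F ih => exact ih.star

/-- The natural maps for sum and product merge only states with equal labels, so the inclusion of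
the derived terms remains a labelling at every stage. -/
theorem term_represents (E : Expr K M) : (term E).Represents E (Subtype.val : Der E → _) := by
  induction E with
  | zero => exact (StdAut.represents_const_zero _).image _
  | one => exact (StdAut.represents_const_one _).image _
  | atom m hm =>
    have hone : ∀ p : Der (atom m hm : Expr K M), p.1 = one := fun p => by
      simpa [derTerms] using p.2
    let _ : Unique (Der (atom m hm : Expr K M)) :=
      ⟨⟨⟨one, by simp [derTerms]⟩⟩, fun p => Subtype.ext (hone p)⟩
    exact StdAut.represents_single hm hone
  | lsmul k F ih => exact ih.lsmul k
  | rsmul F k ih => exact (ih.rsmul k).image (derRsmul_surjective F k)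
  | add F G ihF ihG =>
    refine StdAut.Represents.image (derAdd_surjective F G) ?_
    convert ihF.add ihG using 1
    ext (p | p) <;> rfl
  | mul F G ihF ihG =>
    refine StdAut.Represents.image (derMul_surjective F G) ?_
    convert ihF.mul ihG using 1
    ext (p | p) <;> rfl
  | star F ih => exact ih.star.image (derStar_surjective F)

theorem termAutomaton_represents (E : Expr K M) :
    (termAutomaton E).Represents (Subtype.val ∘ omega E) := by
  have h : Subtype.val ∘ omega E = Sum.elim (fun _ => E) Subtype.val := by
    ext1 (p | p) <;> rfl
  rw [h]
  exact (term_represents E).toAutomaton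

theorem derivedTermAutomaton_represents (E : Expr K M) :
    (derivedTermAutomaton E).Represents (Subtype.val : DState E → _) :=
  (termAutomaton_represents E).image _

theorem derivedTermAutomaton_init (E : Expr K M) :
    (derivedTermAutomaton E).init = fun r => amalgamation K (omega E) (Sum.inl ()) r := by
  ext r
  refine Eq.trans ?_ (congrFun (StdAut.vecMul_init (term E) (omega E)) r)
  simp [derivedTermAutomaton, Automaton.image, Matrix.vecMul, dotProduct, amalgamation,
    Finset.sum_filter, termAutomaton]

theorem omega_isMorphism (E : Expr K M) :
    (termAutomaton E).IsMorphism (derivedTermAutomaton E) (omega E) :=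
  (termAutomaton_represents E).isMorphism (derivedTermAutomaton_represents E)
    Subtype.val_injective (omega_surjective E)
    ((StdAut.vecMul_init _ _).trans (derivedTermAutomaton_init E).symm)

/-- The map sends the initial state to `E` and each position to the derived term labelling it. It
preserves labels, and the states of the target are their own labels, so the morphism criterion
applies. -/
theorem derivedTermAutomaton_isQuotient (E : Expr K M) :
    (derivedTermAutomaton E).IsQuotient (positionAutomaton E) := by
  let φ : Unit ⊕ Pos E → DState E := fun p => omega E
    (p.map id fun p => ⟨posTerm E p, (mem_derTerms_iff_posTerm E _).2 ⟨p, rfl⟩⟩)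
  refine ⟨φ, Automaton.Represents.isMorphism (g := Subtype.val) ?_
    (derivedTermAutomaton_represents E) Subtype.val_injective ?_ ?_⟩
  · have h : Subtype.val ∘ φ = Sum.elim (fun _ => E) (posTerm E) := by
      ext1 (p | p) <;> rfl
    rw [h]
    exact (standard_represents E).toAutomaton
  · refine (omega_surjective E).comp (Sum.map_surjective.2 ⟨Function.surjective_id, ?_⟩)
    rintro ⟨H, hH⟩
    obtain ⟨p, rfl⟩ := (mem_derTerms_iff_posTerm E H).1 hH
    exact ⟨p, rfl⟩
  · exact (StdAut.vecMul_init _ _).trans (derivedTermAutomaton_init E).symm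

theorem omega_eq_iff {K M : Type*} [Monoid M] (E : Expr K M) {p q : Unit ⊕ Der E} (hpq : p ≠ q) :
    E.omega p = E.omega q ↔
      (p = Sum.inl () ∧ ∃ h, q = Sum.inr ⟨E, h⟩) ∨
      (q = Sum.inl () ∧ ∃ h, p = Sum.inr ⟨E, h⟩) := by
  rcases p with p | ⟨p, hp⟩ <;> rcases q with q | ⟨q, hq⟩
  · exact absurd rfl hpq
  · simp only [omega, Sum.elim_inl, Sum.elim_inr, Subtype.mk.injEq]
    constructor
    · rintro rfl; exact Or.inl ⟨trivial, hq, rfl⟩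
    · simp; exact fun _ h => h.symm
  · simp only [omega, Sum.elim_inl, Sum.elim_inr, Subtype.mk.injEq]
    constructor
    · rintro rfl; exact Or.inr ⟨trivial, hp, rfl⟩
    · simp
  · simp only [omega, Sum.elim_inr, Subtype.mk.injEq]
    simpa using hpq

theorem omega_bijective {K M : Type*} [Monoid M] (E : Expr K M) (h : E ∉ derTerms E) : Function.Bijective (omega E) := by
  refine ⟨fun p q hpq => ?_, omega_surjective E⟩
  by_contra hne
  rcases (omega_eq_iff E hne).1 hpq with ⟨-, h', -⟩ | ⟨-, h', -⟩ <;> exact h h'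

end Expr

end WExpr

end

/-! ### Values of expressions and of their derivatives -/

noncomputable section

namespace WExpr

variable {K M : Type*} [Semiring K] [TopologicalSpace K] [Monoid M] [IsGradedMonoid M]

namespace Expr

/-- The evaluation of a linear combination of expressions, with polynomial coefficients, into a
series. -/
def evalLin : (Expr K M →₀ MonoidAlgebra K M) →+ Series K M :=
  Finsupp.liftAddHom fun H =>
    { toFun := fun a => Series.cauchy a.coeff (series H)
      map_zero' := Series.cauchy_zero_left _
      map_add' := fun a b => Series.cauchy_add_left a.coeff b.coeff _ }

theorem evalLin_single (H : Expr K M) (a : MonoidAlgebra K M) :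
    evalLin (Finsupp.single H a) = Series.cauchy a.coeff (series H) := by
  rw [evalLin, Finsupp.liftAddHom_apply_single]; rfl

theorem evalLin_smul (k : K) (d : Expr K M →₀ MonoidAlgebra K M) :
    evalLin (k • d) = k • evalLin d := by
  induction d using Finsupp.induction_linear with
  | zero => simp
  | add d e hd he => rw [smul_add, map_add, map_add, hd, he, smul_add]
  | single H a =>
    rw [Finsupp.smul_single, evalLin_single, evalLin_single, ← Series.cauchy_smul_left]; rfl

theorem evalLin_mapDomain_rsmul (k : K) (d : Expr K M →₀ MonoidAlgebra K M) :
    evalLin (Finsupp.mapDomain (fun H => rsmul H k) d) = MulOpposite.op k • evalLin d := by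
  induction d using Finsupp.induction_linear with
  | zero => simp
  | add d e hd he => rw [Finsupp.mapDomain_add, map_add, map_add, hd, he, smul_add]
  | single H a =>
    rw [Finsupp.mapDomain_single, evalLin_single, evalLin_single,
      ← Series.cauchy_op_smul_right]; rfl

theorem evalLin_mapDomain_mul (G : Expr K M) (d : Expr K M →₀ MonoidAlgebra K M) :
    evalLin (Finsupp.mapDomain (fun H => mul H G) d) = Series.cauchy (evalLin d) (series G) := by
  induction d using Finsupp.induction_linear with
  | zero => simp [Series.cauchy_zero_left]
  | add d e hd he => rw [Finsupp.mapDomain_add, map_add, map_add, hd, he, Series.cauchy_add_left]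
  | single H a =>
    rw [Finsupp.mapDomain_single, evalLin_single, evalLin_single, Series.cauchy_assoc]; rfl

/-- Properness is inherited from the left factor of a Cauchy product. It is the hypothesis on `L` in
`Series.starrable_and_star_eq`. -/
theorem evalLin_deriv_apply_one (E : Expr K M) : evalLin (deriv E) 1 = 0 := by
  induction E with
  | zero => simp [deriv]
  | one => simp [deriv]
  | atom m hm =>
    rw [deriv, evalLin_single]
    exact Series.cauchy_apply_one_of_proper (by simp [hm]) _
  | lsmul k F ih => simp [deriv, evalLin_smul, ih]
  | rsmul F k ih => simp [deriv, evalLin_mapDomain_rsmul, ih]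
  | add F G ihF ihG => simp [deriv, ihF, ihG]
  | mul F G ihF ihG =>
    simp [deriv, evalLin_smul, evalLin_mapDomain_mul, ihG,
      Series.cauchy_apply_one_of_proper ihF]
  | star F ih =>
    simp [deriv, evalLin_smul, evalLin_mapDomain_mul, Series.cauchy_apply_one_of_proper ih]

/-- The series denoted by a valid expression is defined, and it is given by the constant term and
the derivative of the expression. -/
theorem seriesDefined_and_series_eq [IsStrongSemiring K] (E : Expr K M) (hE : E.Valid) :
    E.SeriesDefined ∧ series E = constTerm E • Series.mono 1 + evalLin (deriv E) := by
  induction E with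
  | zero => exact ⟨trivial, by simp [series, constTerm, deriv]⟩
  | one => exact ⟨trivial, by simp [series, constTerm, deriv]⟩
  | atom m hm =>
    refine ⟨trivial, ?_⟩
    have h : ((MonoidAlgebra.single m (1 : K)).coeff : Series K M) = Series.mono m := by
      classical
      ext x
      simp [Series.mono, Finsupp.single_apply, eq_comm]
    rw [deriv, evalLin_single, h, series, series, Series.cauchy_one, constTerm, zero_smul,
      zero_add]
  | lsmul k F ih =>
    obtain ⟨hd, hs⟩ := ih hE
    refine ⟨hd, ?_⟩
    rw [deriv, evalLin_smul, constTerm, mul_smul, ← smul_add, ← hs]; rfl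
  | rsmul F k ih =>
    obtain ⟨hd, hs⟩ := ih hE
    refine ⟨hd, ?_⟩
    -- Scalars commute with the unit series, so `k` can be moved to the right of it.
    have h : (constTerm F * k) • (Series.mono 1 : Series K M) =
        MulOpposite.op k • constTerm F • Series.mono 1 := by
      ext x; simp [Series.mono]
    rw [deriv, evalLin_mapDomain_rsmul, constTerm, h, ← smul_add, ← hs]; rfl
  | add F G ihF ihG =>
    obtain ⟨hdF, hsF⟩ := ihF hE.1
    obtain ⟨hdG, hsG⟩ := ihG hE.2
    refine ⟨⟨hdF, hdG⟩, ?_⟩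
    rw [deriv, map_add, constTerm, add_smul, series]
    nth_rw 1 [hsF, hsG]
    abel
  | mul F G ihF ihG =>
    obtain ⟨hdF, hsF⟩ := ihF hE.1
    obtain ⟨hdG, hsG⟩ := ihG hE.2
    refine ⟨⟨hdF, hdG⟩, ?_⟩
    rw [deriv, map_add, evalLin_mapDomain_mul, evalLin_smul, constTerm, series]
    nth_rw 1 [hsF]
    rw [Series.cauchy_add_left, Series.cauchy_smul_left, Series.one_cauchy]
    -- Only the copy of |G| weighted by c(F) is expanded; the one multiplied by the derivative of F
    -- stays whole, as in the product rule.
    nth_rw 1 [hsG]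
    rw [smul_add, mul_smul]
    abel
  | star F ih =>
    obtain ⟨hd, hs⟩ := ih hE.1
    obtain ⟨hstar, heq⟩ :=
      Series.starrable_and_star_eq hE.2 (evalLin_deriv_apply_one F) hs
    refine ⟨⟨hd, hstar⟩, ?_⟩
    rw [deriv, evalLin_smul, evalLin_mapDomain_mul, constTerm, ← smul_add]
    exact heq

/-- The linear system needs the equation for |H| at every state `H`, not only at `E`. Validity is
inherited because the right factors attached to derived terms are subexpressions of `E`. -/
theorem Valid.of_mem_derTerms {K M : Type*} [Semiring K] [TopologicalSpace K] [Monoid M]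
    {E H : Expr K M} (hE : E.Valid) (hH : H ∈ derTerms E) :
    H.Valid := by
  classical
  induction E generalizing H with
  | zero => simp [derTerms] at hH
  | one => simp [derTerms] at hH
  | atom m hm =>
    obtain rfl : H = one := by simpa [derTerms] using hH
    trivial
  | lsmul k F ih => exact ih hE hH
  | rsmul F k ih =>
    obtain ⟨L, hL, rfl⟩ := Finset.mem_image.1 hH
    exact (ih hE hL : L.Valid)
  | add F G ihF ihG =>
    rcases Finset.mem_union.1 hH with h | h
    · exact ihF hE.1 h
    · exact ihG hE.2 h
  | mul F G ihF ihG =>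
    rcases Finset.mem_union.1 hH with h | h
    · obtain ⟨L, hL, rfl⟩ := Finset.mem_image.1 h
      exact ⟨ihF hE.1 hL, hE.2⟩
    · exact ihG hE.2 h
  | star F ih =>
    obtain ⟨L, hL, rfl⟩ := Finset.mem_image.1 hH
    exact ⟨ih hE.1 hL, hE⟩

end Expr

/-! ### The linear system of a proper automaton, and the behaviour -/

namespace Automaton

variable {Q : Type*} [Fintype Q]

/-- The powers of a proper matrix vanish on short elements. -/
theorem coeff_trans_pow_eq_zero {K M Q : Type*} [Semiring K] [Monoid M] [IsGradedMonoid M]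
    [Fintype Q] {len : M → ℕ}
    (hlen : ∀ a b, a ≠ 1 → len b < len (a * b)) (A : Automaton K M Q)
    [DecidableEq Q] (n : ℕ) (p q : Q) (m : M) (hm : len m < n) :
    ((A.trans ^ n) p q).coeff m = 0 := by
  induction n generalizing p m with
  | zero => omega
  | succ n ih =>
    rw [_root_.pow_succ', Matrix.mul_apply, MonoidAlgebra.coeff_sum, Finsupp.finsetSum_apply]
    refine Finset.sum_eq_zero fun r _ => ?_
    have := congrFun (Series.coeff_mul (A.trans p r) ((A.trans ^ n) r q)) m
    rw [this]
    refine Finset.sum_eq_zero fun x hx => ?_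
    by_cases h1 : x.1 = 1
    · rw [h1, A.proper, zero_mul]
    · have := hlen x.1 x.2 h1
      rw [Series.mem_factorisations.1 hx] at this
      rw [ih r x.2 (by omega), mul_zero]

/-- A vector of series which satisfies the linear system of an automaton is given by the star of its
transition matrix. -/
theorem sum_transStar_mul_final (A : Automaton K M Q) (x : Q → Series K M)
    (hx : ∀ p, x p = A.final p • Series.mono 1 + ∑ q, Series.cauchy (A.trans p q).coeff (x q))
    (p : Q) (m : M) : ∑ q, A.transStar p q m * A.final q = x p m := by
  classical
  obtain ⟨len, hlen⟩ := Series.exists_length M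
  have hzero (n : ℕ) (p q : Q) (m : M) (hm : len m < n) : ((A.trans ^ n) p q).coeff m = 0 :=
    coeff_trans_pow_eq_zero (fun a b => (hlen a b).2.1) A n p q m hm
  -- Substituting the system x = T + E x into itself N times gives x = ∑_{n<N} E^n T + E^N x.
  have hiter (N : ℕ) : x p = ∑ n ∈ Finset.range N, ∑ q,
      Series.cauchy ((A.trans ^ n) p q).coeff (A.final q • Series.mono 1) +
      ∑ q, Series.cauchy ((A.trans ^ N) p q).coeff (x q) := by
    induction N with
    | zero =>
      rw [Finset.sum_range_zero, zero_add, Finset.sum_eq_single p]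
      · have : ((1 : MonoidAlgebra K M).coeff : Series K M) = Series.mono 1 := by
          ext m; simp [MonoidAlgebra.one_def, Series.mono, Finsupp.single_apply, eq_comm]
        rw [pow_zero, Matrix.one_apply_eq, this, Series.one_cauchy]
      · intro q _ hq
        rw [pow_zero, Matrix.one_apply_ne hq.symm]
        exact Series.cauchy_zero_left _
      · simp
    | succ N ih =>
      rw [ih, Finset.sum_range_succ, add_assoc]
      congr 1
      rw [Finset.sum_congr rfl fun q _ => by rw [hx q, Series.cauchy_add_right],
        Finset.sum_add_distrib]
      congr 1
      simp only [Series.cauchy_sum_right, ← Series.cauchy_assoc, ← Series.coeff_mul]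
      rw [Finset.sum_comm]
      refine Finset.sum_congr rfl fun r _ => ?_
      rw [← Series.cauchy_sum_left, pow_succ, Matrix.mul_apply, MonoidAlgebra.coeff_sum]
      congr 1
      ext m
      simp
  -- A left factor of `m` has length at most `len m`, so the power `len m + 1` vanishes on all of
  -- them and the remainder disappears at `m`.
  have hrest : (∑ q, Series.cauchy ((A.trans ^ (len m + 1)) p q).coeff (x q)) m = 0 := by
    rw [Finset.sum_apply]
    refine Finset.sum_eq_zero fun q _ => Finset.sum_eq_zero fun y hy => ?_
    have := (hlen y.1 y.2).1
    rw [Series.mem_factorisations.1 hy] at this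
    rw [hzero _ _ _ _ (by omega), zero_mul]
  -- For the same reason the sum defining the star is finite at `m`, so no convergence in `K` is
  -- involved.
  have hts (q : Q) : A.transStar p q m =
      ∑ n ∈ Finset.range (len m + 1), ((A.trans ^ n) p q).coeff m := by
    have : A.transStar p q m = ∑' n : ℕ, ((A.trans ^ n) p q).coeff m := by
      simp only [transStar, Matrix.of_apply]
    rw [this]
    exact tsum_eq_sum fun n hn => hzero n p q m (by simpa using hn)
  rw [hiter (len m + 1), Pi.add_apply, hrest, add_zero, Finset.sum_apply]
  simp only [Finset.sum_apply, Series.cauchy_smul_one_apply, hts, Finset.sum_mul]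
  rw [Finset.sum_comm]

end Automaton

theorem Expr.derivedTermAutomaton_behaviour [IsStrongSemiring K] (E : Expr K M) (hE : E.Valid) :
    (derivedTermAutomaton E).behaviour = series E := by
  classical
  have hrep := derivedTermAutomaton_represents E
  have hsys (p : DState E) : series p.1 = (derivedTermAutomaton E).final p • Series.mono 1 +
      ∑ q, Series.cauchy ((derivedTermAutomaton E).trans p q).coeff (series q.1) := by
    have hp : p.1.Valid := by
      rcases Finset.mem_insert.1 p.2 with h | h
      · rwa [h]
      · exact hE.of_mem_derTerms h
    rw [hrep.final, (seriesDefined_and_series_eq p.1 hp).2, ← hrep.trans p, map_sum]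
    simp only [evalLin_single]
  ext m
  simp only [Automaton.behaviour, mul_assoc, ← Finset.mul_sum]
  simp only [Automaton.sum_transStar_mul_final _ _ hsys, derivedTermAutomaton_init]
  -- The initial vector is the indicator of the state `E`, so only the component |E| of the solution
  -- remains.
  simp only [amalgamation, Matrix.of_apply, ite_mul, one_mul, zero_mul, Finset.sum_ite_eq,
    Finset.mem_univ, if_true]
  rfl

end WExpr

end

theorem theoremt {K : Type*} [Semiring K] [TopologicalSpace K] [WExpr.IsStrongSemiring K]
    {M : Type*} [Monoid M] [WExpr.IsGradedMonoid M]
    (E : WExpr.Expr K M) (hE : E.Valid) :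
    E.derivedTermAutomaton.IsQuotient E.positionAutomaton ∧
    (E.SeriesDefined ∧ E.derivedTermAutomaton.behaviour = E.series) ∧
    E.termAutomaton.IsMorphism E.derivedTermAutomaton E.omega ∧
    (E ∈ E.derTerms → ∀ p q, p ≠ q →
      (E.omega p = E.omega q ↔
        (p = Sum.inl () ∧ ∃ h, q = Sum.inr ⟨E, h⟩) ∨
        (q = Sum.inl () ∧ ∃ h, p = Sum.inr ⟨E, h⟩))) ∧
    (E ∉ E.derTerms → Function.Bijective E.omega) :=
  ⟨E.derivedTermAutomaton_isQuotient,
    ⟨(E.seriesDefined_and_series_eq hE).1, E.derivedTermAutomaton_behaviour hE⟩,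
    E.omega_isMorphism, fun _ _ _ => E.omega_eq_iff, E.omega_bijective⟩
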